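/- Let $n\ge 0$, let $e_1,\dots,e_{n+1}$ be the standard orthonormal basis of $\mathbb R^{n+1}$, and let $\Phi=\{e_i-e_j: i\ne j\}$ be the root system of type $A_n$, with positive roots $\Phi^+=\{e_i-e_j : i<j\}$ and fundamental system $\Pi=\{e_i-e_{i+1}: 1\le i\le n\}$. Let $W=W(A_n)$ be the Weyl group, generated by the reflections $w_r$, $r\in\Phi$. For $J,K,L\subseteq\Pi$ let $W_J=\langle w_r : r\in J\rangle$; let $X_J=\{w\in W: w(J)\subseteq\Phi^+\}$ be the set of distinguished representatives of the left cosets $wW_J$; let $x_J=\sum_{d\in X_J}d\in\mathbb Q[W]$; let $X_{JK}=X_J^{-1}\cap X_K$; and let $a_{JKL}$ be the number of $w\in X_{JK}$ with $w^{-1}(J)\cap K=L$. Write $J\sim K$ if $w(J)=K$ for some $w\in W$, and let $[x_J]=\{x_K: K\subseteq\Pi,\ K\sim J\}$. Let $\Sigma_W(A_n)$ be the $\mathbb Q$-vector space with basis the set of distinct classes $[x_J]$, $J\subseteq\Pi$, with the bilinear multiplication $$[x_J][x_K]=\sum_{L\subseteq K}a_{JKL}[x_L]$$ and identity $[x_\Pi]$.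 Let $\chi_J$ be the permutation character of $W$ acting on the left cosets of $W_J$, that is, $\chi_J(w)$ is the number of left cosets of $W_J$ fixed by $w$. Let $G(W(A_n))$ be the $\mathbb Z$-module spanned by all $\chi_J$, and let $G_{\mathbb Q}(W(A_n))$ be the $\mathbb Q$-vector space spanned by them, both inside the ring of rational-valued class functions on $W$ with pointwise operations. Then the multiplication of $\Sigma_W(A_n)$ is well defined (the displayed formula holds for all $J,K\subseteq\Pi$, whichever representatives of the classes are used), and there is exactly one $\mathbb Q$-linear map $\psi$ from $\Sigma_W(A_n)$ to the class functions on $W$ with $\psi([x_J])=\chi_J$ for all $J\subseteq\Pi$. This map is injective with image $G_{\mathbb Q}(W(A_n))$, and it satisfies $\psi(yz)=\psi(y)\psi(z)$ for all $y,z\in\Sigma_W(A_n)$ and $\psi([x_\Pi])=1$; so it is an isomorphism of $\mathbb Q$-algebras from $\Sigma_W(A_n)$ onto $G_{\mathbb Q}(W(A_n))$. Moreover, $\psi$ maps the integral span of the classes $[x_J]$ onto $G(W(A_n))$. -/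

import Mathlib

namespace TypeA

noncomputable section

/-- The Euclidean space of dimension `n + 1`. -/
abbrev V (n : ℕ) : Type := EuclideanSpace ℝ (Fin (n + 1))

/-- The vectors `e 0, …, e n` of the standard orthonormal basis. -/
def e {n : ℕ} (i : Fin (n + 1)) : V n := EuclideanSpace.single i 1

/-- The root system `Φ = {e i - e j | i ≠ j}` of type `A_n`. -/
def roots (n : ℕ) : Set (V n) := {r | ∃ i j : Fin (n + 1), i ≠ j ∧ r = e i - e j}

/-- The positive roots `e i - e j`, `i < j`. -/
def posRoots (n : ℕ) : Set (V n) := {r | ∃ i j : Fin (n + 1), i < j ∧ r = e i - e j}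

/-- The simple root `e i - e (i + 1)`; the fundamental system `Π` is the range of this
(injective) map, and subsets of `Π` are encoded as `J : Finset (Fin n)`. -/
def simpleRoot {n : ℕ} (i : Fin n) : V n := e i.castSucc - e i.succ

/-- The set of simple roots encoded by `J`. -/
def rootsOf {n : ℕ} (J : Finset (Fin n)) : Set (V n) := simpleRoot '' (J : Set (Fin n))

/-- The orthogonal reflection `w_r` in the hyperplane `r^⊥`. -/
def refl {n : ℕ} (r : V n) : V n ≃ₗᵢ[ℝ] V n := (ℝ ∙ r)ᗮ.reflection

/-- The Weyl group `W(A_n)`, generated by the reflections `w_r`, `r ∈ Φ`. -/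
def W (n : ℕ) : Subgroup (V n ≃ₗᵢ[ℝ] V n) := Subgroup.closure (refl '' roots n)

/-- The image `w(S)` of a set of vectors under an element of the Weyl group. -/
def img {n : ℕ} (w : W n) (S : Set (V n)) : Set (V n) :=
  (w : V n ≃ₗᵢ[ℝ] V n) '' S

/-- The simple root is a root. -/
theorem simpleRoot_mem {n : ℕ} (i : Fin n) : simpleRoot i ∈ roots n :=
  ⟨i.castSucc, i.succ, (Fin.castSucc_lt_succ (i := i)).ne, rfl⟩

/-- The reflection in a simple root, as an element of the Weyl group. -/
def simpleRefl {n : ℕ} (i : Fin n) : W n :=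
  ⟨refl (simpleRoot i), Subgroup.subset_closure ⟨_, simpleRoot_mem i, rfl⟩⟩

/-- The standard parabolic subgroup `W_J`, generated by the `w_r` with `r ∈ J`. -/
def parabolic {n : ℕ} (J : Finset (Fin n)) : Subgroup (W n) :=
  Subgroup.closure (simpleRefl '' (J : Set (Fin n)))

/-- The set `X_J` of distinguished representatives of the left cosets `w W_J`:
the elements `w` with `w(J) ⊆ Φ⁺`
(equivalently, those that have the least length in their coset). -/
def X {n : ℕ} (J : Finset (Fin n)) : Set (W n) := {w | img w (rootsOf J) ⊆ posRoots n}

/-- The set `X_{JK} = X_J⁻¹ ∩ X_K` of distinguished double coset representatives. -/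
def XX {n : ℕ} (J K : Finset (Fin n)) : Set (W n) := {w | w⁻¹ ∈ X J ∧ w ∈ X K}

/-- `a J K L` is the number of `w ∈ X_{JK}` with `w⁻¹(J) ∩ K = L`. -/
def a {n : ℕ} (J K L : Finset (Fin n)) : ℕ :=
  Set.ncard {w : W n | w ∈ XX J K ∧ img w⁻¹ (rootsOf J) ∩ rootsOf K = rootsOf L}

/-- The element `x_J = ∑_{d ∈ X_J} d` of the rational group algebra
(the sum is finite, because `W n` is finite). -/
def x {n : ℕ} (J : Finset (Fin n)) : MonoidAlgebra ℚ (W n) :=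
  ∑ᶠ d ∈ X J, MonoidAlgebra.of ℚ (W n) d

/-- `J ∼ K`: there is `w ∈ W` with `w(J) = K`. -/
def Conj {n : ℕ} (J K : Finset (Fin n)) : Prop := ∃ w : W n, img w (rootsOf J) = rootsOf K

/-- The equivalence class `[x_J] = {x_K | K ∼ J}`, as a set. -/
def classSet {n : ℕ} (J : Finset (Fin n)) : Set (MonoidAlgebra ℚ (W n)) :=
  {y | ∃ K : Finset (Fin n), Conj K J ∧ y = x K}

/-- The set of all equivalence classes `[x_J]`. -/
def XClass (n : ℕ) : Type := {c : Set (MonoidAlgebra ℚ (W n)) // ∃ J, c = classSet J}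

/-- The class `[x_J]` as an element of the set of classes. -/
def toClass {n : ℕ} (J : Finset (Fin n)) : XClass n := ⟨classSet J, J, rfl⟩

/-- Some `J` with `c = [x_J]`. -/
def XClass.rep {n : ℕ} (c : XClass n) : Finset (Fin n) := c.2.choose

/-- The rational vector space `Σ_W(A_n)`, with the distinct classes `[x_J]` as a basis. -/
def DescentAlg (n : ℕ) : Type := XClass n →₀ ℚ

instance (n : ℕ) : AddCommGroup (DescentAlg n) := inferInstanceAs (AddCommGroup (XClass n →₀ ℚ))

instance (n : ℕ) : Module ℚ (DescentAlg n) := inferInstanceAs (Module ℚ (XClass n →₀ ℚ))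

/-- The basis indexed by the classes. -/
def DescentAlg.basis (n : ℕ) : Module.Basis (XClass n) ℚ (DescentAlg n) :=
  Module.Basis.ofRepr (LinearEquiv.refl ℚ (XClass n →₀ ℚ))

/-- The basis element `[x_J]` of `Σ_W(A_n)`. -/
def cls {n : ℕ} (J : Finset (Fin n)) : DescentAlg n := DescentAlg.basis n (toClass J)

/-- The bilinear multiplication with `[x_J] [x_K] = ∑_{L ⊆ K} a_{JKL} [x_L]`, where `J` and `K`
run over chosen representatives of the classes. That the formula then holds for all `J` and `K`
is a claim about this definition. -/
def DescentAlg.mulHom (n : ℕ) : DescentAlg n →ₗ[ℚ] DescentAlg n →ₗ[ℚ] DescentAlg n :=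
  (DescentAlg.basis n).constr ℚ fun c => (DescentAlg.basis n).constr ℚ fun d =>
    ∑ L ∈ d.rep.powerset, (a c.rep d.rep L : ℚ) • cls L

instance (n : ℕ) : Mul (DescentAlg n) := ⟨fun y z => DescentAlg.mulHom n y z⟩

/-- The identity is `[x_Π]`. -/
instance (n : ℕ) : One (DescentAlg n) := ⟨cls Finset.univ⟩

/-- The algebra of rational-valued class functions on a group (pointwise operations). -/
def ClassFun (G : Type) [Group G] : Subalgebra ℚ (G → ℚ) where
  carrier := {f | ∀ g h : G, f (g * h * g⁻¹) = f h}
  mul_mem' hf hg g h := by simp [hf g h, hg g h]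
  add_mem' hf hg g h := by simp [hf g h, hg g h]
  algebraMap_mem' r g h := rfl

/-- Conjugate elements have equally many fixed points. -/
theorem card_fixedBy_conj {G α : Type} [Group G] [MulAction G α] (g h : G) :
    Nat.card (MulAction.fixedBy α (g * h * g⁻¹)) = Nat.card (MulAction.fixedBy α h) := by
  refine Nat.card_congr ⟨fun y => ⟨g⁻¹ • y.1, ?_⟩, fun y => ⟨g • y.1, ?_⟩, ?_, ?_⟩
  · have := y.2
    rw [MulAction.mem_fixedBy] at this ⊢
    conv_rhs => rw [← this]
    simp [mul_smul]
  · have := y.2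
    rw [MulAction.mem_fixedBy] at this ⊢
    simp [mul_smul, this]
  · intro y; simp
  · intro y; simp

/-- The permutation character `χ_J` of `W(A_n)` acting on the left cosets of `W_J`:
its value at `w` is the number of cosets fixed by `w`. -/
def chi {n : ℕ} (J : Finset (Fin n)) : ClassFun (W n) :=
  ⟨fun w => (Nat.card (MulAction.fixedBy (W n ⧸ parabolic J) w) : ℚ),
    fun g h => congrArg Nat.cast (card_fixedBy_conj g h)⟩

/-- The module `G(W(A_n))` of class functions generated by all `χ_J`, with coefficients in `R`
(used for `R = ℤ` and for `R = ℚ`). -/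
def GMod (R : Type) [CommRing R] [Algebra R ℚ] (n : ℕ) : Submodule R (ClassFun (W n)) :=
  Submodule.span R (Set.range fun J : Finset (Fin n) => chi J)

/-- The subgroup of `Σ_W(A_n)` of the integral combinations of the classes `[x_J]`. -/
def intForm (n : ℕ) : Submodule ℤ (DescentAlg n) :=
  Submodule.span ℤ (Set.range fun J : Finset (Fin n) => cls J)

end

end TypeA

/-! The Weyl group is the symmetric group on n+1 points (`permW`), and a subset J of the simple
roots cuts these points into consecutive blocks. Then W_J is the Young subgroup preserving the
blocks, and the distinguished representatives are the permutations increasing on each block.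

Two facts carry the proof. Mackey's formula `chi_mul_chi` gives the χ_J the structure constants
a_{JKL}: a product of two coset spaces splits into orbits indexed by X_{JK}, and the stabilizer
attached to d is W_L, where L consists of the simple roots in K that d sends into J
(`mem_young_meet_iff`). Triangularity, `exists_chi_triangular`, gives linear independence: if χ_J is
nonzero at a Coxeter element of W_K, then |K| ≤ |J|, and equality forces J ∼ K.

As χ_J depends only on the class of J (`chi_eq_of_conj`), [x_J] ↦ χ_J extends to a linear map ψ,
which is injective and multiplicative. Well-definedness of the multiplication needs no direct
comparison of the a_{JKL}: Mackey's formula holds for all J and K, and injectivity of ψ pulls it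
back. -/

open Equiv

namespace TypeA

/-! ### Young subgroups and distinguished coset representatives in the symmetric group -/

section Blocks

variable {n : ℕ}

theorem perm_apply_inv (σ : Perm (Fin (n + 1))) (i : Fin (n + 1)) : σ (σ⁻¹ i) = i :=
  σ.apply_symm_apply i

theorem perm_inv_apply (σ : Perm (Fin (n + 1))) (i : Fin (n + 1)) : σ⁻¹ (σ i) = i :=
  σ.symm_apply_apply i

/-- The index of the block containing `i`, when `Fin (n + 1)` is cut between `k` and `k + 1`
for every `k ∉ J`. -/
def block (J : Finset (Fin n)) (i : Fin (n + 1)) : ℕ :=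
  (Finset.univ.filter fun k : Fin n => k ∉ J ∧ k.castSucc < i).card

/-- The adjacent transposition of `k` and `k + 1`. -/
def adj (k : Fin n) : Perm (Fin (n + 1)) := swap k.castSucc k.succ

/-- The Young subgroup of the permutations that preserve all blocks of `J`. -/
def young (J : Finset (Fin n)) : Subgroup (Perm (Fin (n + 1))) where
  carrier := {σ | ∀ i, block J (σ i) = block J i}
  mul_mem' hσ hτ i := by simp [hσ (_), hτ (_)]
  one_mem' i := rfl
  inv_mem' {σ} hσ i := by simpa using (hσ (σ⁻¹ i)).symm

theorem mem_young {J : Finset (Fin n)} {σ : Perm (Fin (n + 1))} :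
    σ ∈ young J ↔ ∀ i, block J (σ i) = block J i := Iff.rfl

/-- `f` is weakly increasing along every step inside a block of `J`. -/
def MonoOn {α : Type*} [Preorder α] (J : Finset (Fin n)) (f : Fin (n + 1) → α) : Prop :=
  ∀ k ∈ J, f k.castSucc ≤ f k.succ

theorem block_succ_of_mem {J : Finset (Fin n)} {k : Fin n} (hk : k ∈ J) :
    block J k.succ = block J k.castSucc := by
  unfold block
  congr 1
  ext l
  simp only [Finset.mem_filter, Finset.mem_univ, true_and, and_congr_right_iff]
  intro hl
  have : l ≠ k := by rintro rfl; exact hl hk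
  simp only [Fin.lt_def, Fin.val_castSucc, Fin.val_succ]
  have : l.val ≠ k.val := fun h => this (Fin.ext h)
  omega

theorem block_succ_of_notMem {J : Finset (Fin n)} {k : Fin n} (hk : k ∉ J) :
    block J k.succ = block J k.castSucc + 1 := by
  unfold block
  rw [← Finset.card_insert_of_notMem (a := k) (by simp)]
  congr 1
  ext l
  simp only [Finset.mem_filter, Finset.mem_univ, true_and, Finset.mem_insert]
  simp only [Fin.lt_def, Fin.val_castSucc, Fin.val_succ, Fin.ext_iff]
  constructor
  · rintro ⟨h1, h2⟩
    by_cases h : l.val = k.val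
    · exact Or.inl h
    · exact Or.inr ⟨h1, by omega⟩
  · rintro (h | ⟨h1, h2⟩)
    · obtain rfl : l = k := Fin.ext h
      exact ⟨hk, by omega⟩
    · exact ⟨h1, by omega⟩

theorem block_mono (J : Finset (Fin n)) : Monotone (block J) := fun i j hij =>
  Finset.card_le_card fun k hk => by
    simp only [Finset.mem_filter, Finset.mem_univ, true_and] at hk ⊢
    exact ⟨hk.1, hk.2.trans_le hij⟩

/-- A step between two elements of the same block belongs to `J`. -/
theorem mem_of_block_eq {J : Finset (Fin n)} {i j : Fin (n + 1)} (h : block J i = block J j)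
    {k : Fin n} (hi : i ≤ k.castSucc) (hj : k.succ ≤ j) : k ∈ J := by
  by_contra hk
  have h1 := block_mono J hi
  have h2 := block_mono J hj
  rw [block_succ_of_notMem hk] at h2
  omega

/-- A property propagating along steps. -/
theorem rel_of_steps {r : Fin (n + 1) → Fin (n + 1) → Prop} (hr : ∀ i, r i i)
    (ht : ∀ i j k, r i j → r j k → r i k) {i j : Fin (n + 1)} (hij : i ≤ j)
    (h : ∀ k : Fin n, i ≤ k.castSucc → k.succ ≤ j → r k.castSucc k.succ) : r i j := by
  induction j using Fin.induction with
  | zero => obtain rfl : i = 0 := Fin.le_zero_iff.mp hij; exact hr _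
  | succ k ih =>
    rcases hij.lt_or_eq with hlt | rfl
    · have hik : i ≤ k.castSucc := Fin.le_castSucc_iff.mpr hlt
      exact ht _ _ _ (ih hik fun l h1 h2 =>
        h l h1 (h2.trans (Fin.castSucc_lt_succ (i := k)).le)) (h k hik le_rfl)
    · exact hr _

theorem MonoOn.le {α : Type*} [Preorder α] {J : Finset (Fin n)} {f : Fin (n + 1) → α}
    (hf : MonoOn J f) {i j : Fin (n + 1)} (hij : i ≤ j) (hb : block J i = block J j) :
    f i ≤ f j :=
  rel_of_steps (r := fun i j => f i ≤ f j) (fun _ => le_rfl) (fun _ _ _ => le_trans) hij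
    fun k h1 h2 => hf k (mem_of_block_eq hb h1 h2)

theorem MonoOn.lt {J : Finset (Fin n)} {σ : Perm (Fin (n + 1))}
    (hf : MonoOn J σ) {i j : Fin (n + 1)} (hij : i < j) (hb : block J i = block J j) :
    σ i < σ j :=
  lt_of_le_of_ne (hf.le hij.le hb) fun h => hij.ne (σ.injective h)

theorem block_congr {J : Finset (Fin n)} {i j : Fin (n + 1)} (hij : i ≤ j)
    (h : ∀ k : Fin n, i ≤ k.castSucc → k.succ ≤ j → k ∈ J) : block J i = block J j :=
  rel_of_steps (r := fun i j => block J i = block J j) (fun _ => rfl) (fun _ _ _ => Eq.trans) hij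
    fun k h1 h2 => (block_succ_of_mem (h k h1 h2)).symm

theorem adj_mem_young {J : Finset (Fin n)} {k : Fin n} (hk : k ∈ J) : adj k ∈ young J := by
  intro i
  unfold adj
  rcases eq_or_ne i k.castSucc with rfl | h1
  · rw [swap_apply_left, block_succ_of_mem hk]
  rcases eq_or_ne i k.succ with rfl | h2
  · rw [swap_apply_right, block_succ_of_mem hk]
  · rw [swap_apply_of_ne_of_ne h1 h2]

/-- Rearranging a function inside the blocks of `J` does not change it, if it is increasing on
the blocks before and after. -/
theorem MonoOn.comp_eq {α : Type*} [LinearOrder α] {J : Finset (Fin n)} {f : Fin (n + 1) → α}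
    {σ : Perm (Fin (n + 1))} (hf : MonoOn J f) (hσ : σ ∈ young J) (hfσ : MonoOn J (f ∘ σ)) :
    f ∘ σ = f := by
  -- Pairing with the block number in lexicographic order turns increase on blocks into global
  -- monotonicity, so uniqueness of the sorted rearrangement applies.
  have key : ∀ g : Fin (n + 1) → α, MonoOn J g →
      Monotone fun i => toLex (block J i, g i) := by
    intro g hg i j hij
    rw [Prod.Lex.toLex_le_toLex]
    rcases (block_mono J hij).lt_or_eq with h | h
    · exact Or.inl h
    · exact Or.inr ⟨h, hg.le hij h⟩
  have h1 := key f hf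
  have h2 := key _ hfσ
  have e : (fun i => toLex (block J i, f i)) ∘ σ = fun i => toLex (block J i, (f ∘ σ) i) := by
    funext i
    simp [mem_young.mp hσ i]
  have := Tuple.unique_monotone (f := fun i => toLex (block J i, f i)) (σ := σ) (τ := 1)
    (by rw [e]; exact h2) (by simpa using h1)
  funext i
  have h3 := congrFun this i
  simpa using (congrArg (fun p => (ofLex p).2) h3)

/-- The weight `∑ i, i * σ i`, which increases when an inversion is removed. -/
def weight (σ : Perm (Fin (n + 1))) : ℕ := ∑ i : Fin (n + 1), (i : ℕ) * (σ i : ℕ)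

theorem weight_inv (σ : Perm (Fin (n + 1))) : weight σ⁻¹ = weight σ := by
  unfold weight
  rw [← Equiv.sum_comp σ]
  simp [mul_comm]

/-- Only the positions k and k+1 contribute to the change, and it equals σ(k) − σ(k+1) > 0. -/
theorem weight_mul_adj {σ : Perm (Fin (n + 1))} {k : Fin n} (h : σ k.succ < σ k.castSucc) :
    weight σ < weight (σ * adj k) := by
  have hne : k.castSucc ≠ k.succ := (Fin.castSucc_lt_succ (i := k)).ne
  have split : ∀ τ : Perm (Fin (n + 1)), weight τ = (k.castSucc : ℕ) * (τ k.castSucc : ℕ) +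
      ((k.succ : ℕ) * (τ k.succ : ℕ) +
        ∑ i ∈ (Finset.univ.erase k.castSucc).erase k.succ, (i : ℕ) * (τ i : ℕ)) := fun τ => by
    rw [Finset.add_sum_erase (Finset.univ.erase k.castSucc) (fun i : Fin (n + 1) => (i : ℕ) * (τ i : ℕ))
      (Finset.mem_erase.mpr ⟨hne.symm, Finset.mem_univ k.succ⟩),
      Finset.add_sum_erase _ (fun i : Fin (n + 1) => (i : ℕ) * (τ i : ℕ)) (Finset.mem_univ k.castSucc)]
    rfl
  rw [split, split]
  rw [Finset.sum_congr rfl (g := fun i : Fin (n + 1) => (i : ℕ) * ((σ * adj k) i : ℕ))]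
  · simp only [Perm.mul_apply, adj, swap_apply_left, swap_apply_right, Fin.val_castSucc,
      Fin.val_succ]
    have : (σ k.succ : ℕ) < σ k.castSucc := h
    nlinarith
  · intro i hi
    simp only [Finset.mem_erase, Finset.mem_univ, and_true] at hi
    simp [adj, swap_apply_of_ne_of_ne hi.2 hi.1]

/-- The element of largest weight in a double coset of two subgroups generated by adjacent
transpositions is increasing on blocks on both sides. -/
theorem exists_monoOn_closure (J K : Finset (Fin n)) (σ : Perm (Fin (n + 1))) :
    ∃ u ∈ Subgroup.closure (adj '' (J : Set (Fin n))),
    ∃ v ∈ Subgroup.closure (adj '' (K : Set (Fin n))),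
      MonoOn J ⇑(u * σ * v)⁻¹ ∧ MonoOn K ⇑(u * σ * v) := by
  let S : Set (Perm (Fin (n + 1))) :=
    {τ | ∃ u ∈ Subgroup.closure (adj '' (J : Set (Fin n))),
      ∃ v ∈ Subgroup.closure (adj '' (K : Set (Fin n))), τ = u * σ * v}
  obtain ⟨d, ⟨u, hu, v, hv, rfl⟩, hmax⟩ := (Set.toFinite S).exists_maximalFor weight S
    ⟨σ, 1, one_mem _, 1, one_mem _, by simp⟩
  have hmax' : ∀ τ ∈ S, ¬ weight (u * σ * v) < weight τ := fun τ hτ h =>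
    absurd (hmax hτ h.le) (not_le.mpr h)
  refine ⟨u, hu, v, hv, fun k hk => not_lt.mp fun h => ?_, fun k hk => not_lt.mp fun h => ?_⟩
  -- The weight is invariant under inversion, so the right-hand argument applied to the inverse
  -- handles left multiplication.
  · have := weight_mul_adj h
    rw [← weight_inv, ← weight_inv (_ * _), inv_inv] at this
    refine hmax' _ ⟨(adj k)⁻¹ * u, mul_mem (inv_mem (Subgroup.subset_closure ⟨k, hk, rfl⟩)) hu,
      v, hv, rfl⟩ (by simpa [mul_assoc] using this)
  · exact hmax' _ ⟨u, hu, v * adj k, mul_mem hv (Subgroup.subset_closure ⟨k, hk, rfl⟩), rfl⟩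
      (by simpa [mul_assoc] using weight_mul_adj h)

/-- Factors from the generated subgroup make any σ in the Young subgroup increasing on blocks while
staying in it; such a permutation is the identity by `MonoOn.comp_eq`. -/
theorem closure_adj (J : Finset (Fin n)) :
    Subgroup.closure (adj '' (J : Set (Fin n))) = young J := by
  have hle : Subgroup.closure (adj '' (J : Set (Fin n))) ≤ young J := by
    rw [Subgroup.closure_le]
    rintro _ ⟨k, hk, rfl⟩
    exact adj_mem_young hk
  refine le_antisymm hle fun σ hσ => ?_
  obtain ⟨u, hu, v, hv, -, h⟩ := exists_monoOn_closure J J σ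
  have hd : (u * σ * v)⁻¹ ∈ young J := inv_mem (mul_mem (mul_mem (hle hu) hσ) (hle hv))
  have := h.comp_eq hd (fun k hk => by
    simpa using (Fin.castSucc_lt_succ (i := k)).le)
  have h1 : u * σ * v = 1 := by
    ext i
    have := congrFun this i
    simp only [Function.comp_apply, perm_apply_inv] at this
    simp [← this]
  have h2 : σ = u⁻¹ * v⁻¹ := by
    rw [mul_assoc, mul_eq_one_iff_inv_eq] at h1
    rw [h1]; simp
  rw [h2]
  exact mul_mem (inv_mem hu) (inv_mem hv)

theorem exists_monoOn (J K : Finset (Fin n)) (σ : Perm (Fin (n + 1))) :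
    ∃ u ∈ young J, ∃ v ∈ young K, MonoOn J ⇑(u * σ * v)⁻¹ ∧ MonoOn K ⇑(u * σ * v) := by
  simpa only [closure_adj] using exists_monoOn_closure J K σ

/-- Distinguished representatives of left cosets are unique. -/
theorem eq_of_monoOn {J : Finset (Fin n)} {σ τ : Perm (Fin (n + 1))} (hσ : MonoOn J σ)
    (hτ : MonoOn J τ) (h : σ⁻¹ * τ ∈ young J) : σ = τ := by
  have := hσ.comp_eq h (by simpa [Function.comp_def] using hτ)
  ext i
  have := congrFun this i
  simp only [Function.comp_apply, Perm.mul_apply, perm_apply_inv] at this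
  rw [this]

/-- Distinguished representatives of double cosets are unique. -/
theorem eq_of_monoOn_double {J K : Finset (Fin n)} {σ τ u v : Perm (Fin (n + 1))}
    (hσ : MonoOn K σ) (hσ' : MonoOn J ⇑σ⁻¹) (hτ : MonoOn K τ) (hτ' : MonoOn J ⇑τ⁻¹)
    (hu : u ∈ young J) (hv : v ∈ young K) (h : σ * v = u * τ) : σ = τ := by
  have hb : ∀ i, block J (σ (v i)) = block J (τ i) := fun i => by
    have := congrArg (fun p : Perm (Fin (n + 1)) => p i) h
    simp only [Perm.mul_apply] at this
    rw [this, hu]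
  -- Since u preserves J-blocks, `block J ∘ τ` is the rearrangement of `block J ∘ σ` by v. Both
  -- increase on the blocks of K, so they agree.
  have key : (block J ∘ σ) ∘ v = block J ∘ σ :=
    MonoOn.comp_eq (J := K) (fun k hk => block_mono J (hσ k hk)) hv fun k hk => by
      simpa only [Function.comp_apply, hb] using block_mono J (hτ k hk)
  have hστ : ∀ i, block J (σ i) = block J (τ i) := fun i => by
    rw [← hb]; exact (congrFun key i).symm
  rw [← inv_inj]
  refine eq_of_monoOn hσ' hτ' fun i => ?_
  simp [hστ]

/-- If `σ` is increasing on a block and its inverse is increasing on a block, then steps go to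
steps. -/
theorem step_of_monoOn {J K : Finset (Fin n)} {σ : Perm (Fin (n + 1))} (hσ : MonoOn K σ)
    (hσ' : MonoOn J ⇑σ⁻¹) {k : Fin n} (hk : k ∈ K)
    (hb : block J (σ k.castSucc) = block J (σ k.succ)) :
    ∃ j ∈ J, σ k.castSucc = j.castSucc ∧ σ k.succ = j.succ := by
  have hlt : σ k.castSucc < σ k.succ :=
    hσ.lt Fin.castSucc_lt_succ (block_succ_of_mem hk).symm
  have hne : σ k.castSucc ≠ Fin.last n := (hlt.trans_le (Fin.le_last _)).ne
  obtain ⟨j, hj⟩ := Fin.exists_castSucc_eq.mpr hne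
  have hle : j.succ ≤ σ k.succ := Fin.castSucc_lt_iff_succ_le.mp (hj ▸ hlt)
  have hjJ : j ∈ J := mem_of_block_eq hb hj.ge hle
  refine ⟨j, hjJ, hj.symm, ?_⟩
  -- Otherwise the preimage of j+1 would lie strictly between k and k+1.
  by_contra hne'
  have hlt' : j.succ < σ k.succ := lt_of_le_of_ne hle (Ne.symm hne')
  have e1 : block J j.succ = block J (σ k.castSucc) := by rw [block_succ_of_mem hjJ, hj]
  have h1 : σ⁻¹ (σ k.castSucc) < σ⁻¹ j.succ :=
    hσ'.lt (hj ▸ Fin.castSucc_lt_succ) e1.symm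
  have h2 : σ⁻¹ j.succ < σ⁻¹ (σ k.succ) := hσ'.lt hlt' (e1.trans hb)
  simp only [perm_inv_apply, Fin.lt_def, Fin.val_castSucc, Fin.val_succ] at h1 h2
  omega

/-- The steps of `K` that `σ` maps to steps of `J`. -/
def meet (J K : Finset (Fin n)) (σ : Perm (Fin (n + 1))) : Finset (Fin n) :=
  K.filter fun k => ∃ j ∈ J, σ k.castSucc = j.castSucc ∧ σ k.succ = j.succ

theorem meet_subset (J K : Finset (Fin n)) (σ : Perm (Fin (n + 1))) : meet J K σ ⊆ K :=
  Finset.filter_subset _ _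

theorem mem_young_of_subset {K L : Finset (Fin n)} (h : L ⊆ K) : young L ≤ young K := by
  rw [← closure_adj, ← closure_adj]
  exact Subgroup.closure_mono (Set.image_mono (by exact_mod_cast h))

theorem conj_adj {j k : Fin n} {σ : Perm (Fin (n + 1))} (h1 : σ k.castSucc = j.castSucc)
    (h2 : σ k.succ = j.succ) : σ * adj k * σ⁻¹ = adj j := by
  rw [adj, adj, ← h1, ← h2, Equiv.swap_apply_apply]

theorem conj_mem_young_of_steps {J L : Finset (Fin n)} {σ : Perm (Fin (n + 1))}
    (h : ∀ k ∈ L, ∃ j ∈ J, σ k.castSucc = j.castSucc ∧ σ k.succ = j.succ)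
    {v : Perm (Fin (n + 1))} (hv : v ∈ young L) : σ * v * σ⁻¹ ∈ young J := by
  have : young L ≤ (young J).comap (MulAut.conj σ).toMonoidHom := by
    rw [← closure_adj L, Subgroup.closure_le]
    rintro _ ⟨k, hk, rfl⟩
    obtain ⟨j, hj, h1, h2⟩ := h k hk
    change σ * adj k * σ⁻¹ ∈ young J
    rw [conj_adj h1 h2]
    exact adj_mem_young hj
  exact this hv

/-- For distinguished σ the intersection of W_K with σ⁻¹W_Jσ is again standard parabolic. This
identifies the stabilizers in Mackey's formula. -/
theorem mem_young_meet_iff {J K : Finset (Fin n)} {σ : Perm (Fin (n + 1))} (hσ : MonoOn K σ)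
    (hσ' : MonoOn J ⇑σ⁻¹) {v : Perm (Fin (n + 1))} :
    v ∈ young (meet J K σ) ↔ v ∈ young K ∧ σ * v * σ⁻¹ ∈ young J := by
  constructor
  · intro hv
    exact ⟨mem_young_of_subset (meet_subset J K σ) hv,
      conj_mem_young_of_steps (fun k hk => (Finset.mem_filter.mp hk).2) hv⟩
  · rintro ⟨hv, hJ⟩
    have hJ' : ∀ i, block J (σ (v i)) = block J (σ i) := fun i => by simpa using hJ (σ i)
    have key : ∀ i j : Fin (n + 1), i ≤ j → block K i = block K j →
        block J (σ i) = block J (σ j) → block (meet J K σ) i = block (meet J K σ) j := by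
      intro i j hij hb hb'
      refine block_congr hij fun k h1 h2 => ?_
      have hk := mem_of_block_eq hb h1 h2
      refine Finset.mem_filter.mpr ⟨hk, step_of_monoOn hσ hσ' hk ?_⟩
      have hks := (Fin.castSucc_lt_succ (i := k)).le
      have b1 : block K i = block K k.castSucc :=
        le_antisymm (block_mono K h1) (hb ▸ block_mono K (hks.trans h2))
      have b2 : block K k.succ = block K j := by rw [block_succ_of_mem hk, ← b1, hb]
      -- The J-blocks of σ(i), σ(k), σ(k+1), σ(j) weakly increase and the outer two agree, so all
      -- four agree.
      have c1 := block_mono J (hσ.le h1 b1)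
      have c2 := block_mono J (hσ k hk)
      have c3 := block_mono J (hσ.le h2 b2)
      omega
    intro i
    rcases le_total (v i) i with h | h
    · exact key _ _ h (hv i) (hJ' i)
    · exact (key _ _ h (hv i).symm (hJ' i).symm).symm

end Blocks

end TypeA

namespace TypeA

/-! ### Coxeter elements and comparison of block partitions -/

section Triangular

variable {n : ℕ}

/-- A Coxeter element of the Young subgroup: functions invariant under it are constant on
blocks. -/
theorem exists_coxeter (K : Finset (Fin n)) : ∃ c ∈ young K, ∀ f : Fin (n + 1) → ℕ,
    (∀ i, f (c i) = f i) → ∀ k ∈ K, f k.castSucc = f k.succ := by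
  -- The added clause lets the induction append the largest step m: the previous c fixes m+1, so
  -- invariance evaluated at m yields f(m) = f(m+1).
  suffices H : ∃ c ∈ young K, (∀ i, (∀ k ∈ K, k.succ < i) → c i = i) ∧
      ∀ f : Fin (n + 1) → ℕ, (∀ i, f (c i) = f i) → ∀ k ∈ K, f k.castSucc = f k.succ by
    obtain ⟨c, hc, -, h⟩ := H
    exact ⟨c, hc, h⟩
  induction K using Finset.induction_on_max with
  | empty => exact ⟨1, one_mem _, fun i _ => rfl, fun f _ k hk => by simp at hk⟩
  | insert m K hm ih =>
    obtain ⟨c, hc, hfix, h⟩ := ih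
    have hms : c m.succ = m.succ := hfix _ fun k hk => by simpa using hm k hk
    refine ⟨c * adj m, mul_mem (mem_young_of_subset (Finset.subset_insert m K) hc)
      (adj_mem_young (Finset.mem_insert_self m K)), fun i hi => ?_, fun f hf => ?_⟩
    · have him := hi m (Finset.mem_insert_self m K)
      rw [Perm.mul_apply, adj, swap_apply_of_ne_of_ne
        ((Fin.castSucc_lt_succ (i := m)).trans him).ne' him.ne']
      exact hfix i fun k hk => hi k (Finset.mem_insert_of_mem hk)
    · have hfm : f m.castSucc = f m.succ := by
        have := hf m.castSucc
        rw [Perm.mul_apply, adj, swap_apply_left, hms] at this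
        exact this.symm
      have hadj : ∀ i, f (adj m i) = f i := fun i => by
        unfold adj
        rcases eq_or_ne i m.castSucc with rfl | h1
        · rw [swap_apply_left, hfm]
        rcases eq_or_ne i m.succ with rfl | h2
        · rw [swap_apply_right, hfm]
        · rw [swap_apply_of_ne_of_ne h1 h2]
      have hfc : ∀ i, f (c i) = f i := fun i => by
        have := hf (adj m i)
        rwa [Perm.mul_apply, hadj, adj, swap_apply_self] at this
      intro k hk
      rcases Finset.mem_insert.mp hk with rfl | hk
      · exact hfm
      · exact h f hfc k hk

theorem image_block (J : Finset (Fin n)) :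
    Finset.univ.image (block J) = Finset.range (n - J.card + 1) := by
  have hzero : block J 0 = 0 := by simp [block]
  have hlast : block J (Fin.last n) = n - J.card := by
    have : (Finset.univ.filter fun k : Fin n => k ∉ J ∧ k.castSucc < Fin.last n) = Jᶜ := by
      ext k
      simp [Fin.castSucc_lt_last]
    rw [block, this, Finset.card_compl, Fintype.card_fin]
  have hsurj : ∀ i : Fin (n + 1), ∀ t ≤ block J i, ∃ j, block J j = t := by
    intro i
    induction i using Fin.induction with
    | zero => exact fun t ht => ⟨0, by omega⟩
    | succ k ih =>
      intro t ht
      by_cases h : t ≤ block J k.castSucc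
      · exact ih t h
      · refine ⟨k.succ, ?_⟩
        by_cases hk : k ∈ J
        · rw [block_succ_of_mem hk] at ht
          omega
        · rw [block_succ_of_notMem hk] at ht ⊢
          omega
  ext t
  simp only [Finset.mem_image, Finset.mem_univ, true_and, Finset.mem_range, Nat.lt_succ_iff]
  constructor
  · rintro ⟨i, rfl⟩
    rw [← hlast]
    exact block_mono J (Fin.le_last i)
  · intro ht
    exact hsurj (Fin.last n) t (hlast ▸ ht)

theorem eq_of_block_eq {α : Type*} {K : Finset (Fin n)} {f : Fin (n + 1) → α}
    (hf : ∀ k ∈ K, f k.castSucc = f k.succ) {i j : Fin (n + 1)} (h : block K i = block K j) :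
    f i = f j := by
  wlog hij : i ≤ j generalizing i j
  · exact (this h.symm (le_of_not_ge hij)).symm
  exact rel_of_steps (r := fun i j => f i = f j) (fun _ => rfl) (fun _ _ _ => Eq.trans) hij
    fun k h1 h2 => hf k (mem_of_block_eq h h1 h2)

/-- If the blocks of `K` refine a permutation of the blocks of `J`, then `K` has at most as many
elements as `J`, and in case of equality some permutation maps the steps of `J` to those
of `K`. -/
theorem exists_step_map {J K : Finset (Fin n)} {w : Perm (Fin (n + 1))}
    (h : ∀ k ∈ K, block J (w⁻¹ k.castSucc) = block J (w⁻¹ k.succ)) :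
    K.card ≤ J.card ∧ (K.card = J.card → ∃ d : Perm (Fin (n + 1)),
      ∀ j ∈ J, ∃ k ∈ K, d j.castSucc = k.castSucc ∧ d j.succ = k.succ) := by
  have hft : Function.FactorsThrough (fun i => block J (w⁻¹ i)) (block K) := fun i j hij =>
    eq_of_block_eq (f := fun i => block J (w⁻¹ i)) h hij
  obtain ⟨g, hg⟩ : ∃ g : ℕ → ℕ, ∀ i, g (block K i) = block J (w⁻¹ i) :=
    ⟨_, hft.extend_apply (fun _ => 0)⟩
  -- Thus g maps the n−|K|+1 blocks of K onto the n−|J|+1 blocks of J; equal cardinalities make it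
  -- bijective.
  have himg : (Finset.univ.image (block K)).image g = Finset.univ.image (block J) := by
    ext t
    simp only [Finset.mem_image, Finset.mem_univ, true_and, exists_exists_eq_and, hg]
    exact ⟨fun ⟨i, hi⟩ => ⟨_, hi⟩, fun ⟨i, hi⟩ => ⟨w i, by rwa [perm_inv_apply]⟩⟩
  have hJ : J.card ≤ n := by simpa using J.card_le_univ
  have hK : K.card ≤ n := by simpa using K.card_le_univ
  refine ⟨?_, fun hcard => ?_⟩
  · have := Finset.card_image_le (s := Finset.univ.image (block K)) (f := g)
    rw [himg, image_block, image_block, Finset.card_range, Finset.card_range] at this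
    omega
  · have hinj : Set.InjOn g (Finset.univ.image (block K)) := by
      rw [← Finset.card_image_iff, himg, image_block, image_block, hcard]
    have hiff : ∀ i j, block J (w⁻¹ i) = block J (w⁻¹ j) → block K i = block K j := by
      intro i j hij
      refine hinj ?_ ?_ (by rw [hg, hg, hij]) <;> simp
    -- With the empty set on the left only the coset of w modulo the Young subgroup of J is
    -- adjusted; its increasing representative maps the blocks of J onto those of K in order.
    obtain ⟨u, hu, v, hv, -, hd⟩ := exists_monoOn ∅ J w
    have hu1 : u = 1 := by simpa [← closure_adj] using hu
    subst hu1
    rw [one_mul] at hd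
    have hb : ∀ i, block J ((w * v)⁻¹ i) = block J (w⁻¹ i) := fun i => by
      rw [mul_inv_rev, Perm.mul_apply]
      exact inv_mem hv _
    refine ⟨w * v, fun j hj => step_of_monoOn hd (fun k hk => ?_) hj ?_⟩
    · refine not_lt.mp fun hlt => ?_
      have := hd.le hlt.le (by rw [hb, hb, h k hk])
      rw [perm_apply_inv, perm_apply_inv] at this
      exact absurd this (not_le.mpr Fin.castSucc_lt_succ)
    · refine hiff _ _ ?_
      rw [← hb, ← hb, perm_inv_apply, perm_inv_apply, block_succ_of_mem hj]

end Triangular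

/-! ### The Weyl group as a group of permutations -/

section Bridge

variable {n : ℕ}

/-- The permutation of coordinates, as an isometry. -/
noncomputable def permIso : Perm (Fin (n + 1)) →* (V n ≃ₗᵢ[ℝ] V n) where
  toFun σ := LinearIsometryEquiv.piLpCongrLeft 2 ℝ ℝ σ
  map_one' := by
    ext v i
    simp [LinearIsometryEquiv.piLpCongrLeft_apply]
    rfl
  map_mul' σ τ := by
    ext v i
    simp [LinearIsometryEquiv.piLpCongrLeft_apply]
    rfl

theorem permIso_e (σ : Perm (Fin (n + 1))) (i : Fin (n + 1)) : permIso σ (e i) = e (σ i) :=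
  LinearIsometryEquiv.piLpCongrLeft_single σ i 1

theorem e_apply (i j : Fin (n + 1)) : (e i : V n) j = if j = i then 1 else 0 := by
  simp [e]

theorem e_injective : Function.Injective (e : Fin (n + 1) → V n) := fun i j h => by
  have := congrArg (fun v : V n => v i) h
  simpa [e_apply] using this

theorem e_sub_inj {i j k l : Fin (n + 1)} (hij : i ≠ j) (h : (e i - e j : V n) = e k - e l) :
    i = k ∧ j = l := by
  have h1 := congrArg (fun v : V n => v i) h
  have h2 := congrArg (fun v : V n => v j) h
  simp only [PiLp.sub_apply, e_apply, if_neg hij, if_neg hij.symm, if_true] at h1 h2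
  constructor
  · by_contra hne
    rw [if_neg hne] at h1
    split_ifs at h1 <;> norm_num at h1
  · by_contra hne
    rw [if_neg hne] at h2
    split_ifs at h2 <;> norm_num at h2

theorem ext_e {f g : V n ≃ₗᵢ[ℝ] V n} (h : ∀ i, f (e i) = g (e i)) : f = g := by
  have : f.toLinearEquiv.toLinearMap = g.toLinearEquiv.toLinearMap :=
    (EuclideanSpace.basisFun (Fin (n + 1)) ℝ).toBasis.ext fun i => by simpa [e] using h i
  ext1 v
  exact LinearMap.congr_fun this v

theorem refl_e_sub {i j : Fin (n + 1)} (hij : i ≠ j) :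
    refl (e i - e j : V n) = permIso (swap i j) := by
  have hn : ‖(e i : V n)‖ = ‖(e j : V n)‖ := by simp [e]
  have hi : refl (e i - e j : V n) (e i) = e j := Submodule.reflection_sub hn
  refine ext_e fun k => ?_
  rw [permIso_e]
  rcases eq_or_ne k i with rfl | h1
  · rw [swap_apply_left, hi]
  rcases eq_or_ne k j with rfl | h2
  · rw [swap_apply_right]
    exact (congrArg _ hi).symm.trans (Submodule.reflection_reflection _ _)
  · rw [swap_apply_of_ne_of_ne h1 h2]
    refine Submodule.reflection_mem_subspace_eq_self ?_
    rw [Submodule.mem_orthogonal_singleton_iff_inner_right]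
    simp [e, inner_sub_left, EuclideanSpace.inner_single_left, h1.symm, h2.symm]

theorem permIso_injective : Function.Injective (permIso (n := n)) := fun σ τ h => by
  ext i : 1
  exact e_injective (by rw [← permIso_e, h, permIso_e])

theorem W_eq_range : W n = (permIso (n := n)).range := by
  refine le_antisymm ?_ ?_
  · refine (Subgroup.closure_le _).mpr ?_
    rintro _ ⟨_, ⟨i, j, hij, rfl⟩, rfl⟩
    exact ⟨swap i j, (refl_e_sub hij).symm⟩
  -- Transpositions generate the symmetric group, and each one acts as the reflection in a root.
  · rw [MonoidHom.range_eq_map, ← Perm.closure_isSwap, MonoidHom.map_closure]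
    refine Subgroup.closure_mono ?_
    rintro _ ⟨_, ⟨i, j, hij, rfl⟩, rfl⟩
    exact ⟨e i - e j, ⟨i, j, hij, rfl⟩, refl_e_sub hij⟩

/-- The isomorphism of the symmetric group with the Weyl group. -/
noncomputable def permW : Perm (Fin (n + 1)) ≃* W n :=
  (MonoidHom.ofInjective permIso_injective).trans (MulEquiv.subgroupCongr W_eq_range.symm)

theorem permW_coe (σ : Perm (Fin (n + 1))) :
    ((permW σ : W n) : V n ≃ₗᵢ[ℝ] V n) = permIso σ := rfl

instance : Finite (W n) := Finite.of_equiv _ permW.toEquiv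

theorem permW_simpleRoot (σ : Perm (Fin (n + 1))) (k : Fin n) :
    ((permW σ : W n) : V n ≃ₗᵢ[ℝ] V n) (simpleRoot k) = e (σ k.castSucc) - e (σ k.succ) := by
  rw [permW_coe, simpleRoot, map_sub, permIso_e, permIso_e]

theorem simpleRoot_injective : Function.Injective (simpleRoot (n := n)) := fun j _ h =>
  Fin.castSucc_injective _ (e_sub_inj (Fin.castSucc_lt_succ (i := j)).ne h).1

theorem rootsOf_injective : Function.Injective (rootsOf (n := n)) := fun J K h => by
  exact_mod_cast Set.image_injective.mpr simpleRoot_injective h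

theorem simpleRefl_eq (k : Fin n) : simpleRefl k = permW (adj k) :=
  Subtype.ext (refl_e_sub (Fin.castSucc_lt_succ (i := k)).ne)

theorem permW_mem_X {J : Finset (Fin n)} {σ : Perm (Fin (n + 1))} :
    permW σ ∈ X J ↔ MonoOn J σ := by
  constructor
  · intro h k hk
    obtain ⟨i, j, hij, he⟩ := h ⟨_, ⟨k, hk, rfl⟩, rfl⟩
    rw [permW_simpleRoot] at he
    obtain ⟨h1, h2⟩ := e_sub_inj (σ.injective.ne (Fin.castSucc_lt_succ (i := k)).ne) he
    rw [h1, h2]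
    exact hij.le
  · rintro h _ ⟨_, ⟨k, hk, rfl⟩, rfl⟩
    exact ⟨_, _, lt_of_le_of_ne (h k hk) (σ.injective.ne (Fin.castSucc_lt_succ (i := k)).ne),
      permW_simpleRoot σ k⟩

theorem permW_mem_XX {J K : Finset (Fin n)} {σ : Perm (Fin (n + 1))} :
    permW σ ∈ XX J K ↔ MonoOn J ⇑σ⁻¹ ∧ MonoOn K σ := by
  rw [← permW_mem_X, ← permW_mem_X, map_inv]
  rfl

theorem permW_mem_parabolic {J : Finset (Fin n)} {σ : Perm (Fin (n + 1))} :
    permW σ ∈ parabolic J ↔ σ ∈ young J := by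
  have : parabolic J = (young J).map permW.toMonoidHom := by
    rw [← closure_adj, MonoidHom.map_closure, parabolic, Set.image_image]
    simp [simpleRefl_eq]
  rw [this]
  simp

theorem permW_simpleRoot_mem_rootsOf {J : Finset (Fin n)} {σ : Perm (Fin (n + 1))} {k : Fin n} :
    ((permW σ : W n) : V n ≃ₗᵢ[ℝ] V n) (simpleRoot k) ∈ rootsOf J ↔
      ∃ j ∈ J, σ k.castSucc = j.castSucc ∧ σ k.succ = j.succ := by
  rw [permW_simpleRoot]
  constructor
  · rintro ⟨j, hj, h⟩
    obtain ⟨h1, h2⟩ := e_sub_inj (Fin.castSucc_lt_succ (i := j)).ne h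
    exact ⟨j, hj, h1.symm, h2.symm⟩
  · rintro ⟨j, hj, h1, h2⟩
    exact ⟨j, hj, by rw [h1, h2]; rfl⟩

theorem mem_img_inv {w : W n} {S : Set (V n)} {v : V n} :
    v ∈ img w⁻¹ S ↔ (w : V n ≃ₗᵢ[ℝ] V n) v ∈ S := by
  constructor
  · rintro ⟨u, hu, rfl⟩
    have : (w : V n ≃ₗᵢ[ℝ] V n) (((w⁻¹ : W n) : V n ≃ₗᵢ[ℝ] V n) u) = u :=
      (w : V n ≃ₗᵢ[ℝ] V n).apply_symm_apply u
    rwa [this]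
  · intro h
    exact ⟨_, h, (w : V n ≃ₗᵢ[ℝ] V n).symm_apply_apply v⟩

theorem img_inv_inter (J K : Finset (Fin n)) (σ : Perm (Fin (n + 1))) :
    img (permW σ)⁻¹ (rootsOf J) ∩ rootsOf K = rootsOf (meet J K σ) := by
  ext v
  simp only [Set.mem_inter_iff, mem_img_inv]
  constructor
  · rintro ⟨h, k, hk, rfl⟩
    exact ⟨k, Finset.mem_filter.mpr ⟨hk, permW_simpleRoot_mem_rootsOf.mp h⟩, rfl⟩
  · rintro ⟨k, hk, rfl⟩
    obtain ⟨h1, h2⟩ := Finset.mem_filter.mp hk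
    exact ⟨permW_simpleRoot_mem_rootsOf.mpr h2, k, h1, rfl⟩

/-- The hypothesis gives only d(J) ⊆ K; counting makes it an equality. -/
theorem conj_of_step_map {J K : Finset (Fin n)} (hcard : K.card = J.card)
    {d : Perm (Fin (n + 1))}
    (h : ∀ j ∈ J, ∃ k ∈ K, d j.castSucc = k.castSucc ∧ d j.succ = k.succ) : Conj J K := by
  have hfin : ∀ L : Finset (Fin n), (rootsOf L).ncard = L.card := fun L => by
    rw [rootsOf, Set.ncard_image_of_injective _ simpleRoot_injective, Set.ncard_coe_finset]
  refine ⟨permW d, Set.eq_of_subset_of_ncard_le ?_ ?_ ((Finset.finite_toSet K).image _)⟩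
  · rintro _ ⟨_, ⟨j, hj, rfl⟩, rfl⟩
    exact permW_simpleRoot_mem_rootsOf.mpr (h j hj)
  · rw [img, Set.ncard_image_of_injective _ (LinearIsometryEquiv.injective _), hfin, hfin, hcard]

end Bridge

end TypeA

namespace TypeA

/-! ### Mackey decomposition of products of coset spaces -/

section GroupTheory

variable {G : Type*} [Group G]

/-- Mackey's decomposition of a product of two coset spaces, for fixed points: `D` is a system of
double coset representatives. -/
theorem card_fixedBy_mul_card_fixedBy [Finite G] (H K : Subgroup G) (D : Finset G)
    (M : G → Subgroup G) (hM : ∀ d ∈ D, ∀ v, v ∈ M d ↔ v ∈ K ∧ d * v * d⁻¹ ∈ H)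
    (hex : ∀ g, ∃ u ∈ H, ∃ v ∈ K, u * g * v ∈ D)
    (huniq : ∀ d ∈ D, ∀ d' ∈ D, ∀ u ∈ H, ∀ v ∈ K, d * v = u * d' → d = d') (w : G) :
    Nat.card (MulAction.fixedBy (G ⧸ H) w) * Nat.card (MulAction.fixedBy (G ⧸ K) w) =
      ∑ d ∈ D, Nat.card (MulAction.fixedBy (G ⧸ M d) w) := by
  -- The coset of g in the summand of d goes to (gd⁻¹H, gK). This is an equivariant bijection, hence
  -- matches fixed points.
  let F : (Σ d : D, G ⧸ M d) → (G ⧸ H) × (G ⧸ K) := fun p =>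
    Quotient.liftOn' p.2 (fun g => ((g * (p.1 : G)⁻¹ : G), (g : G))) fun g g' h => by
      rw [QuotientGroup.leftRel_apply, hM _ p.1.2] at h
      refine Prod.ext (QuotientGroup.eq.mpr ?_) (QuotientGroup.eq.mpr h.1)
      simpa [mul_assoc] using h.2
  have hF : ∀ (d : D) (g : G), F ⟨d, (g : G ⧸ M d)⟩ =
      (((g * (d : G)⁻¹ : G) : G ⧸ H), (g : G ⧸ K)) :=
    fun _ _ => rfl
  have hFs : ∀ (d : D) (q : G ⧸ M d), F ⟨d, w • q⟩ = w • F ⟨d, q⟩ := by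
    rintro d ⟨g⟩
    change F ⟨d, ((w * g : G) : G ⧸ M d)⟩ = w • F ⟨d, (g : G ⧸ M d)⟩
    rw [hF, hF, mul_assoc]
    rfl
  have hinj : Function.Injective F := by
    rintro ⟨d, ⟨g⟩⟩ ⟨d', ⟨g'⟩⟩ h
    change F ⟨d, (g : G ⧸ M d)⟩ = F ⟨d', (g' : G ⧸ M d')⟩ at h
    rw [hF, hF, Prod.mk.injEq, QuotientGroup.eq, QuotientGroup.eq] at h
    obtain ⟨h1, h2⟩ := h
    have hd : d = d' := Subtype.ext <| huniq _ d.2 _ d'.2 _ h1 _ h2 (by group)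
    subst hd
    congr 1
    refine QuotientGroup.eq.mpr ((hM _ d.2 _).mpr ⟨h2, ?_⟩)
    simpa [mul_assoc] using h1
  have hsurj : Function.Surjective F := by
    rintro ⟨⟨y⟩, ⟨z⟩⟩
    obtain ⟨u, hu, v, hv, hd⟩ := hex (y⁻¹ * z)
    -- With d = u y⁻¹ z v, one has zv·d⁻¹ = y u⁻¹ ∈ yH and zv ∈ zK.
    refine ⟨⟨⟨_, hd⟩, ((z * v : G) : G ⧸ M _)⟩, ?_⟩
    rw [hF]
    refine Prod.ext (QuotientGroup.eq.mpr ?_) (QuotientGroup.eq.mpr ?_)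
    · simpa [mul_assoc] using hu
    · simpa using hv
  have hfix : ∀ p : Σ d : D, G ⧸ M d, w • p.2 = p.2 ↔ w • F p = F p := by
    rintro ⟨d, q⟩
    rw [← hFs, hinj.eq_iff]
    simp
  rw [← Nat.card_prod, ← Finset.sum_coe_sort, ← Nat.card_sigma]
  symm
  refine Nat.card_eq_of_bijective (fun p => ⟨⟨(F ⟨p.1, p.2.1⟩).1, ?_⟩, ⟨(F ⟨p.1, p.2.1⟩).2, ?_⟩⟩)
    ⟨?_, ?_⟩
  · exact congrArg Prod.fst ((hfix ⟨p.1, p.2.1⟩).mp p.2.2)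
  · exact congrArg Prod.snd ((hfix ⟨p.1, p.2.1⟩).mp p.2.2)
  · rintro ⟨d, q, hq⟩ ⟨d', q', hq'⟩ h
    have := hinj (Prod.ext (congrArg (fun p => p.1.1) h) (congrArg (fun p => p.2.1) h))
    obtain ⟨rfl, h⟩ := Sigma.mk.inj_iff.mp this
    obtain rfl := eq_of_heq h
    rfl
  · rintro ⟨⟨y, hy⟩, ⟨z, hz⟩⟩
    obtain ⟨⟨d, q⟩, hq⟩ := hsurj (y, z)
    have h := (hfix ⟨d, q⟩).mpr (by rw [hq]; exact Prod.ext hy hz)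
    exact ⟨⟨d, q, h⟩, Prod.ext (Subtype.ext (congrArg Prod.fst hq))
      (Subtype.ext (congrArg Prod.snd hq))⟩

theorem card_fixedBy_top (w : G) :
    Nat.card (MulAction.fixedBy (G ⧸ (⊤ : Subgroup G)) w) = 1 := by
  have := QuotientGroup.subsingleton_quotient_top (G := G)
  exact Nat.card_eq_one_iff_unique.mpr ⟨inferInstance, ⟨⟨1, Subsingleton.elim _ _⟩⟩⟩

/-- Mackey's formula with the whole group as second subgroup: there is one double coset, and g may
represent it. -/
theorem card_fixedBy_of_conj [Finite G] {H K : Subgroup G} {g : G}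
    (h : ∀ v, v ∈ H ↔ g * v * g⁻¹ ∈ K) (w : G) :
    Nat.card (MulAction.fixedBy (G ⧸ H) w) = Nat.card (MulAction.fixedBy (G ⧸ K) w) := by
  have := card_fixedBy_mul_card_fixedBy K ⊤ {g} (fun _ => H)
    (fun d hd v => by rw [Finset.mem_singleton.mp hd, h]; simp)
    (fun y => ⟨1, one_mem _, y⁻¹ * g, Subgroup.mem_top _, by simp⟩)
    (fun d hd d' hd' _ _ _ _ _ => by
      rw [Finset.mem_singleton.mp hd, Finset.mem_singleton.mp hd']) w
  rw [card_fixedBy_top, mul_one, Finset.sum_singleton] at this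
  exact this.symm

end GroupTheory

/-! ### Mackey's formula and triangularity for the permutation characters -/

section Characters

variable {n : ℕ}

theorem chi_apply (J : Finset (Fin n)) (w : W n) :
    (chi J : W n → ℚ) w = Nat.card (MulAction.fixedBy (W n ⧸ parabolic J) w) := rfl

theorem chi_univ : chi (Finset.univ : Finset (Fin n)) = 1 := by
  have : parabolic (Finset.univ : Finset (Fin n)) = ⊤ := by
    rw [eq_top_iff]
    intro w _
    obtain ⟨σ, rfl⟩ := permW.surjective w
    exact permW_mem_parabolic.mpr fun i => by simp [block]
  refine Subtype.ext (funext fun w => ?_)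
  rw [chi_apply, this, card_fixedBy_top]
  simp

theorem chi_eq_of_conj {J K : Finset (Fin n)} (h : Conj J K) : chi J = chi K := by
  obtain ⟨w, hw⟩ := h
  obtain ⟨σ, rfl⟩ := permW.surjective w
  have h1 : ∀ j ∈ J, ∃ k ∈ K, σ j.castSucc = k.castSucc ∧ σ j.succ = k.succ := fun j hj =>
    permW_simpleRoot_mem_rootsOf.mp (hw ▸ ⟨_, ⟨j, hj, rfl⟩, rfl⟩)
  have h2 : ∀ k ∈ K, ∃ j ∈ J, σ⁻¹ k.castSucc = j.castSucc ∧ σ⁻¹ k.succ = j.succ := by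
    intro k hk
    obtain ⟨_, ⟨j, hj, rfl⟩, he⟩ : simpleRoot k ∈ img (permW σ) (rootsOf J) :=
      hw ▸ ⟨k, hk, rfl⟩
    obtain ⟨e1, e2⟩ := e_sub_inj (σ.injective.ne (Fin.castSucc_lt_succ (i := j)).ne)
      ((permW_simpleRoot σ j).symm.trans he)
    exact ⟨j, hj, by rw [← e1, perm_inv_apply], by rw [← e2, perm_inv_apply]⟩
  refine Subtype.ext (funext fun g => ?_)
  rw [chi_apply, chi_apply, card_fixedBy_of_conj (g := permW σ) fun v => ?_]
  obtain ⟨τ, rfl⟩ := permW.surjective v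
  rw [← map_inv, ← map_mul, ← map_mul, permW_mem_parabolic, permW_mem_parabolic]
  refine ⟨conj_mem_young_of_steps h1, fun h => ?_⟩
  simpa [mul_assoc] using conj_mem_young_of_steps h2 h

open Classical in
/-- Mackey's formula for the permutation characters. -/
theorem chi_mul_chi (J K : Finset (Fin n)) :
    chi J * chi K = ∑ L ∈ K.powerset, (a J K L : ℚ) • chi L := by
  let D : Finset (W n) := (Set.toFinite (XX J K)).toFinset
  let m : W n → Finset (Fin n) := fun w => meet J K (permW.symm w)
  have hD : ∀ w, w ∈ D ↔ w ∈ XX J K := fun w => Set.Finite.mem_toFinset _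
  -- The structure constants count the double coset representatives by the parabolic subgroup
  -- attached to them, so grouping the Mackey sum by L produces them.
  have ha : ∀ L, a J K L = (D.filter fun w => m w = L).card := by
    intro L
    rw [a, ← Set.ncard_coe_finset]
    congr 1
    ext w
    obtain ⟨σ, rfl⟩ := permW.surjective w
    simp only [Set.mem_ofPred_eq, Finset.coe_filter, hD, img_inv_inter, rootsOf_injective.eq_iff, m,
      MulEquiv.symm_apply_apply]
  have hsum : ∑ L ∈ K.powerset, (a J K L : ℚ) • chi L = ∑ d ∈ D, chi (m d) := by
    rw [← Finset.sum_fiberwise_of_maps_to (s := D) (t := K.powerset) (g := m)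
      fun d _ => Finset.mem_powerset.mpr (meet_subset _ _ _)]
    refine Finset.sum_congr rfl fun L _ => ?_
    rw [Finset.sum_congr rfl (g := fun _ => chi L)
      fun d hd => by rw [(Finset.mem_filter.mp hd).2], Finset.sum_const, ha, Nat.cast_smul_eq_nsmul]
  rw [hsum]
  refine Subtype.ext (funext fun w => ?_)
  have key := card_fixedBy_mul_card_fixedBy (parabolic J) (parabolic K) D
    (fun d => parabolic (m d)) ?_ ?_ ?_ w
  · have hs : ((∑ d ∈ D, chi (m d) : ClassFun (W n)) : W n → ℚ) w =
        ∑ d ∈ D, (chi (m d) : W n → ℚ) w := by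
      rw [AddSubmonoidClass.coe_finsetSum, Finset.sum_apply]
    rw [hs]
    change (chi J : W n → ℚ) w * (chi K : W n → ℚ) w = _
    simp only [chi_apply]
    exact_mod_cast key
  · intro d hd v
    obtain ⟨σ, rfl⟩ := permW.surjective d
    obtain ⟨τ, rfl⟩ := permW.surjective v
    obtain ⟨h1, h2⟩ := permW_mem_XX.mp ((hD _).mp hd)
    simp only [m, MulEquiv.symm_apply_apply]
    rw [← map_inv, ← map_mul, ← map_mul, permW_mem_parabolic, permW_mem_parabolic,
      permW_mem_parabolic]
    exact mem_young_meet_iff h2 h1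
  · intro g
    obtain ⟨σ, rfl⟩ := permW.surjective g
    obtain ⟨u, hu, v, hv, h1, h2⟩ := exists_monoOn J K σ
    refine ⟨permW u, permW_mem_parabolic.mpr hu, permW v, permW_mem_parabolic.mpr hv, ?_⟩
    rw [← map_mul, ← map_mul, hD]
    exact permW_mem_XX.mpr ⟨h1, h2⟩
  · intro d hd d' hd' u hu v hv h
    obtain ⟨σ, rfl⟩ := permW.surjective d
    obtain ⟨σ', rfl⟩ := permW.surjective d'
    obtain ⟨τ, rfl⟩ := permW.surjective u
    obtain ⟨τ', rfl⟩ := permW.surjective v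
    obtain ⟨h1, h2⟩ := permW_mem_XX.mp ((hD _).mp hd)
    obtain ⟨h3, h4⟩ := permW_mem_XX.mp ((hD _).mp hd')
    rw [← map_mul, ← map_mul, permW.injective.eq_iff] at h
    rw [eq_of_monoOn_double h2 h1 h4 h3 (permW_mem_parabolic.mp hu) (permW_mem_parabolic.mp hv) h]

/-- The permutation characters are triangular with respect to the Coxeter elements of the
parabolic subgroups. -/
theorem exists_chi_triangular (K : Finset (Fin n)) : ∃ c : W n, (chi K : W n → ℚ) c ≠ 0 ∧
    ∀ J : Finset (Fin n), (chi J : W n → ℚ) c ≠ 0 →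
      K.card ≤ J.card ∧ (K.card = J.card → Conj J K) := by
  have hne : ∀ (J : Finset (Fin n)) (w : W n), (chi J : W n → ℚ) w ≠ 0 ↔
      ∃ g : W n, g⁻¹ * w * g ∈ parabolic J := by
    intro J w
    rw [chi_apply, Nat.cast_ne_zero, Nat.card_ne_zero]
    have hq : ∀ g : W n, w • (g : W n ⧸ parabolic J) = g ↔ g⁻¹ * w * g ∈ parabolic J := by
      intro g
      rw [eq_comm, MulAction.Quotient.smul_coe, QuotientGroup.eq, smul_eq_mul, mul_assoc]
    constructor
    · rintro ⟨⟨⟨g⟩, hg⟩, -⟩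
      exact ⟨g, (hq g).mp hg⟩
    · rintro ⟨g, hg⟩
      exact ⟨⟨g, (hq g).mpr hg⟩, inferInstance⟩
  obtain ⟨c, hc, h⟩ := exists_coxeter K
  refine ⟨permW c, (hne _ _).mpr ⟨1, by simpa using permW_mem_parabolic.mpr hc⟩, fun J hJ => ?_⟩
  obtain ⟨g, hg⟩ := (hne _ _).mp hJ
  obtain ⟨w, rfl⟩ := permW.surjective g
  rw [← map_inv, ← map_mul, ← map_mul, permW_mem_parabolic] at hg
  -- As w⁻¹cw preserves the blocks of J, the function i ↦ `block J (w⁻¹ i)` is c-invariant, hence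
  -- constant on the blocks of K.
  obtain ⟨h1, h2⟩ := exists_step_map (J := J) (K := K) (w := w)
    (h (fun i => block J (w⁻¹ i)) fun i => by simpa using hg (w⁻¹ i))
  exact ⟨h1, fun hcard => (h2 hcard).elim fun d hd => conj_of_step_map hcard hd⟩

end Characters

/-! ### The classes [x_J] and the linear map to class functions -/

section Classes

variable {n : ℕ}

theorem img_img (w w' : W n) (S : Set (V n)) : img w (img w' S) = img (w * w') S :=
  Set.image_image _ _ _

theorem img_one (S : Set (V n)) : img 1 S = S :=
  Set.image_id S

theorem Conj.refl (J : Finset (Fin n)) : Conj J J := ⟨1, img_one _⟩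

theorem Conj.symm {J K : Finset (Fin n)} (h : Conj J K) : Conj K J := by
  obtain ⟨w, hw⟩ := h
  exact ⟨w⁻¹, by rw [← hw, img_img, inv_mul_cancel, img_one]⟩

theorem Conj.trans {J K L : Finset (Fin n)} (h : Conj J K) (h' : Conj K L) : Conj J L := by
  obtain ⟨w, hw⟩ := h
  obtain ⟨w', hw'⟩ := h'
  exact ⟨w' * w, by rw [← img_img, hw, hw']⟩

theorem permW_adj_mem_X {J : Finset (Fin n)} {k : Fin n} : permW (adj k) ∈ X J ↔ k ∉ J := by
  rw [permW_mem_X]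
  constructor
  · intro h hk
    have := h k hk
    rw [adj, swap_apply_left, swap_apply_right] at this
    exact absurd this (not_le.mpr Fin.castSucc_lt_succ)
  · intro hk l hl
    have : l.val ≠ k.val := fun h => hk (Fin.ext h ▸ hl)
    simp only [adj, swap_apply_def, Fin.ext_iff, Fin.val_castSucc, Fin.val_succ]
    split_ifs <;> simp only [Fin.le_def, Fin.val_castSucc, Fin.val_succ] <;> omega

/-- The simple reflections in X_J are exactly those outside J, so J can be recovered. Hence x_J
determines J, and equality of classes means conjugacy. -/
theorem X_injective : Function.Injective (X (n := n)) := fun J K h => by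
  ext k
  rw [← not_iff_not, ← permW_adj_mem_X, ← permW_adj_mem_X, h]

open Classical in
theorem x_coeff (J : Finset (Fin n)) (w : W n) :
    (x J).coeff w = if w ∈ X J then 1 else 0 := by
  rw [x, finsum_mem_eq_finite_toFinset_sum _ (Set.toFinite _)]
  simp [MonoidAlgebra.coeff_sum, Finsupp.single_apply]

theorem x_injective : Function.Injective (x (n := n)) := fun J K h => by
  refine X_injective (Set.ext fun w => ?_)
  have := congrArg (fun y => y.coeff w) h
  simp only [x_coeff] at this
  split_ifs at this <;> simp_all

theorem toClass_eq_iff {J K : Finset (Fin n)} : toClass J = toClass K ↔ Conj J K := by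
  constructor
  · intro h
    have hm : x J ∈ classSet K := by
      rw [← show classSet J = classSet K from congrArg Subtype.val h]
      exact ⟨J, Conj.refl J, rfl⟩
    obtain ⟨L, hL, he⟩ := hm
    rwa [x_injective he]
  · intro h
    refine Subtype.ext (Set.ext fun y => ?_)
    exact ⟨fun ⟨L, hL, he⟩ => ⟨L, hL.trans h, he⟩, fun ⟨L, hL, he⟩ => ⟨L, hL.trans h.symm, he⟩⟩

theorem toClass_rep (c : XClass n) : toClass c.rep = c :=
  Subtype.ext c.2.choose_spec.symm

theorem cls_rep (c : XClass n) : cls c.rep = DescentAlg.basis n c := by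
  rw [cls, toClass_rep]

theorem linearIndependent_chi_rep :
    LinearIndependent ℚ fun c : XClass n => chi c.rep := by
  rw [linearIndependent_iff]
  intro l hl
  by_contra hne
  -- In a dependence relation take a class with |J| maximal: at its Coxeter element every other term
  -- vanishes, since a nonzero one would have the same cardinality and so be the same class.
  obtain ⟨c, hc, hmax⟩ := l.support.exists_max_image (fun c => c.rep.card)
    (Finsupp.support_nonempty_iff.mpr hne)
  obtain ⟨w, hw, htri⟩ := exists_chi_triangular c.rep
  have h : ∑ d ∈ l.support, l d * (chi d.rep : W n → ℚ) w = 0 := by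
    have := congrArg (fun f : ClassFun (W n) => (f : W n → ℚ) w) hl
    rw [Finsupp.linearCombination_apply, Finsupp.sum] at this
    simpa [AddSubmonoidClass.coe_finsetSum, Finset.sum_apply] using this
  rw [Finset.sum_eq_single c] at h
  · exact (mul_ne_zero (Finsupp.mem_support_iff.mp hc) hw) h
  · intro d hd hdc
    by_contra hz
    obtain ⟨h1, h2⟩ := htri d.rep (right_ne_zero_of_mul hz)
    refine hdc ?_
    rw [← toClass_rep d, ← toClass_rep c, toClass_eq_iff]
    exact h2 (le_antisymm h1 (hmax d hd))
  · exact fun h => absurd hc h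

variable {ψ : DescentAlg n →ₗ[ℚ] ClassFun (W n)}

theorem injective_of_map_cls (hψ : ∀ J, ψ (cls J) = chi J) : Function.Injective ψ := by
  rw [← LinearMap.ker_eq_bot, LinearMap.ker_eq_bot']
  intro y hy
  rw [← (DescentAlg.basis n).linearCombination_repr y, Finsupp.apply_linearCombination] at hy
  have : (ψ ∘ DescentAlg.basis n) = fun c : XClass n => chi c.rep :=
    funext fun c => by rw [Function.comp_apply, ← cls_rep, hψ]
  rw [this] at hy
  exact (DescentAlg.basis n).repr.map_eq_zero_iff.mp
    (linearIndependent_iff.mp linearIndependent_chi_rep _ hy)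

theorem map_mul_of_map_cls (hψ : ∀ J, ψ (cls J) = chi J) (y z : DescentAlg n) :
    ψ (y * z) = ψ y * ψ z := by
  have : (DescentAlg.mulHom n).compr₂ ψ =
      (LinearMap.mul ℚ (ClassFun (W n))).compl₁₂ ψ ψ := by
    refine (DescentAlg.basis n).ext fun c => (DescentAlg.basis n).ext fun d => ?_
    have hmul : DescentAlg.mulHom n (DescentAlg.basis n c) (DescentAlg.basis n d) =
        ∑ L ∈ d.rep.powerset, (a c.rep d.rep L : ℚ) • cls L := by
      rw [DescentAlg.mulHom, Module.Basis.constr_basis, Module.Basis.constr_basis]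
    have hb : ∀ c : XClass n, ψ (DescentAlg.basis n c) = chi c.rep := fun c => by
      rw [← cls_rep, hψ]
    have hsum : ψ (∑ L ∈ d.rep.powerset, (a c.rep d.rep L : ℚ) • cls L) =
        ∑ L ∈ d.rep.powerset, (a c.rep d.rep L : ℚ) • chi L := by
      rw [map_sum]
      exact Finset.sum_congr rfl fun L _ => by rw [map_smul, hψ]
    exact (congrArg ψ hmul).trans (hsum.trans ((chi_mul_chi _ _).symm.trans
      (congrArg₂ (· * ·) (hb c) (hb d)).symm))
  exact LinearMap.congr_fun (LinearMap.congr_fun this y) z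

theorem exists_map_cls : ∃ ψ : DescentAlg n →ₗ[ℚ] ClassFun (W n), ∀ J, ψ (cls J) = chi J := by
  refine ⟨(DescentAlg.basis n).constr ℚ fun c => chi c.rep, fun J => ?_⟩
  rw [cls, Module.Basis.constr_basis]
  exact chi_eq_of_conj (toClass_eq_iff.mp (toClass_rep _))

theorem range_of_map_cls (hψ : ∀ J, ψ (cls J) = chi J) : LinearMap.range ψ = GMod ℚ n := by
  have : Submodule.span ℚ (Set.range fun J : Finset (Fin n) => cls J) = ⊤ := by
    rw [eq_top_iff, ← (DescentAlg.basis n).span_eq]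
    refine Submodule.span_mono ?_
    rintro _ ⟨c, rfl⟩
    exact ⟨c.rep, cls_rep c⟩
  rw [LinearMap.range_eq_map, ← this, Submodule.map_span, ← Set.range_comp, GMod]
  simp only [Function.comp_def, hψ]

theorem map_intForm_of_map_cls (hψ : ∀ J, ψ (cls J) = chi J) :
    (intForm n).map (ψ.restrictScalars ℤ) = GMod ℤ n := by
  rw [intForm, Submodule.map_span, ← Set.range_comp, GMod]
  simp only [Function.comp_def, LinearMap.coe_restrictScalars, hψ]

end Classes

end TypeA

theorem proposition2p12 (n : ℕ) :
    -- the multiplication of `Σ_W(A_n)` obeys its defining formula for all `J` and `K`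
    (∀ J K : Finset (Fin n),
      TypeA.cls J * TypeA.cls K = ∑ L ∈ K.powerset, (TypeA.a J K L : ℚ) • TypeA.cls L) ∧
    -- `[x_J] ↦ χ_J` defines exactly one linear map
    (∃! ψ : TypeA.DescentAlg n →ₗ[ℚ] TypeA.ClassFun (TypeA.W n),
      ∀ J, ψ (TypeA.cls J) = TypeA.chi J) ∧
    -- and this map is an isomorphism of rings onto `G(W(A_n))`, over `ℚ` and over `ℤ`
    (∀ ψ : TypeA.DescentAlg n →ₗ[ℚ] TypeA.ClassFun (TypeA.W n),
      (∀ J, ψ (TypeA.cls J) = TypeA.chi J) →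
        Function.Injective ψ ∧
        LinearMap.range ψ = TypeA.GMod ℚ n ∧
        (∀ y z : TypeA.DescentAlg n, ψ (y * z) = ψ y * ψ z) ∧
        ψ 1 = 1 ∧
        (TypeA.intForm n).map (ψ.restrictScalars ℤ) = TypeA.GMod ℤ n) := by
  obtain ⟨ψ, hψ⟩ := TypeA.exists_map_cls (n := n)
  refine ⟨fun J K => ?_, ⟨ψ, hψ, fun φ hφ => ?_⟩, fun φ hφ => ⟨TypeA.injective_of_map_cls hφ,
    TypeA.range_of_map_cls hφ, TypeA.map_mul_of_map_cls hφ, (hφ _).trans TypeA.chi_univ,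
    TypeA.map_intForm_of_map_cls hφ⟩⟩
  -- Independence of the representatives follows by comparing images under the injective ψ, where
  -- Mackey's formula holds for all J and K.
  · apply TypeA.injective_of_map_cls hψ
    rw [TypeA.map_mul_of_map_cls hψ, hψ, hψ, TypeA.chi_mul_chi, map_sum]
    simp only [map_smul, hψ]
  · exact (TypeA.DescentAlg.basis n).ext fun c => by rw [← TypeA.cls_rep, hφ, hψ]
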